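/- Consider the following algorithm on a finite simple graph $G=(V,E)$, run in synchronous rounds. Each vertex $v$ has a fixed cap $\ell_{\max}(v)\in\mathbb N$ and a level $\ell(v)\in\{-\ell_{\max}(v),\dots,\ell_{\max}(v)\}$. In each round, independently of everything else, every vertex $v$ beeps with probability $\min\{2^{-\ell(v)},1\}$ if $\ell(v)<\ell_{\max}(v)$, and does not beep if $\ell(v)=\ell_{\max}(v)$. Then all levels are updated simultaneously: if at least one neighbor of $v$ beeped, then $\ell(v)\gets\min\{\ell(v)+1,\ell_{\max}(v)\}$; otherwise, if $v$ itself beeped, then $\ell(v)\gets-\ell_{\max}(v)$; otherwise $\ell(v)\gets\max\{\ell(v)-1,1\}$. For given levels, let $I$ be the set of all vertices $v$ with $\ell(v)=-\ell_{\max}(v)$ and $\ell(u)=\ell_{\max}(u)$ for every neighbor $u$ of $v$. The levels form a *stable MIS* if $I$ is a maximal independent set of $G$, every vertex lies in $I$ or has a neighbor in $I$, and with probability $1$ the levels never change again. **Theorem.** For all real constants $c_1\ge 15$, $c_2>0$ and $a>0$ there is a constant $C>0$ such that the following holds for every finite graph $G$ with $n$ vertices and maximum degree $\Delta$. Suppose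 that all vertices have the same cap $\ell_{\max}(v)=\ell_{\max}$ with $$\log_2 \max\{\Delta,1\}+c_1\;\le\;\ell_{\max}\;\le\; c_2\log_2 n .$$ Then, from any initial configuration of levels in $\{-\ell_{\max},\dots,\ell_{\max}\}$, the algorithm has reached a stable MIS after $\lfloor C\log_2 n\rfloor$ rounds with probability at least $1-n^{-a}$. -/

import Mathlib

open scoped NNReal ENNReal

namespace BeepingMIS

noncomputable section

open Classical in
/-- The probability with which a vertex of level `l` and cap `m` beeps:
`min {2 ^ (-l), 1}` when `l < m`, and `0` when `l = m`. -/
def beepProb (m : ℕ) (l : ℤ) : ℝ≥0 :=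
  if l < (m : ℤ) then min ((2 : ℝ≥0) ^ (-l)) 1 else 0

theorem beepProb_le_one (m : ℕ) (l : ℤ) : beepProb m l ≤ 1 := by
  unfold beepProb
  split_ifs
  · exact min_le_right _ _
  · exact zero_le_one

variable {V : Type*}

/-- `l` assigns to each vertex `v` a level in `{-lmax v, ..., lmax v}`. -/
def IsConfiguration (lmax : V → ℕ) (l : V → ℤ) : Prop :=
  ∀ v, -(lmax v : ℤ) ≤ l v ∧ l v ≤ (lmax v : ℤ)

/-- Vertex `v` receives a signal when `b` tells which vertices beep. -/
def Hears (G : SimpleGraph V) (b : V → Bool) (v : V) : Prop :=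
  ∃ u, G.Adj v u ∧ b u = true

open Classical in
/-- The update of all levels at the end of a round in which exactly the vertices `v` with
`b v = true` beep. -/
def update (G : SimpleGraph V) (lmax : V → ℕ) (l : V → ℤ) (b : V → Bool) : V → ℤ :=
  fun v =>
    if Hears G b v then min (l v + 1) (lmax v)
    else if b v = true then -(lmax v : ℤ)
    else max (l v - 1) 1

open Classical in
/-- The beeps of one round started with levels `l`: the vertices beep independently of each
other, vertex `v` with probability `beepProb (lmax v) (l v)`. -/
def beeps [Fintype V] (lmax : V → ℕ) (l : V → ℤ) : PMF (V → Bool) :=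
  PMF.ofFintype
    (fun b => ((∏ v, (if b v = true then beepProb (lmax v) (l v)
      else 1 - beepProb (lmax v) (l v)) : ℝ≥0) : ℝ≥0∞))
    (by
      have h := Finset.prod_univ_sum (fun _ : V => (Finset.univ : Finset Bool))
        (fun v c => if c = true then beepProb (lmax v) (l v)
          else 1 - beepProb (lmax v) (l v))
      rw [Fintype.piFinset_univ] at h
      rw [← ENNReal.ofNNReal_finsetSum, ← h]
      simp [beepProb_le_one])

/-- One round of the algorithm: the law of the levels at its end. -/
def step [Fintype V] (G : SimpleGraph V) (lmax : V → ℕ) (l : V → ℤ) : PMF (V → ℤ) :=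
  (beeps lmax l).map (update G lmax l)

/-- The law of the levels after `T` rounds, from the initial levels `l`. -/
def run [Fintype V] (G : SimpleGraph V) (lmax : V → ℕ) : ℕ → (V → ℤ) → PMF (V → ℤ)
  | 0, l => PMF.pure l
  | T + 1, l => (run G lmax T l).bind (step G lmax)

/-- The set computed by the algorithm: the vertices of level `-lmax v` all of whose neighbors
are at their maximal level. -/
def misSet (G : SimpleGraph V) (lmax : V → ℕ) (l : V → ℤ) : Set V :=
  {v | l v = -(lmax v : ℤ) ∧ ∀ u, G.Adj v u → l u = (lmax u : ℤ)}

/-- The stable vertices: those of the computed set and their neighbors. -/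
def stableSet (G : SimpleGraph V) (lmax : V → ℕ) (l : V → ℤ) : Set V :=
  {v | v ∈ misSet G lmax l ∨ ∃ u ∈ misSet G lmax l, G.Adj u v}

/-- The levels `l` form a stable MIS: the computed set is a maximal independent set, every vertex
is stable, and with probability one the levels never change again. -/
def IsStableMIS [Fintype V] (G : SimpleGraph V) (lmax : V → ℕ) (l : V → ℤ) : Prop :=
  Maximal G.IsIndepSet (misSet G lmax l) ∧
  stableSet G lmax l = Set.univ ∧
  ∀ k : ℕ, run G lmax k l = PMF.pure l

end

end BeepingMIS

namespace BeepingMIS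

noncomputable section

open Finset Classical

/-! A vertex that beeps while all its neighbors are silent drops to the bottom level and pushes its
neighbors to positive levels (`dominates_update_of_alone`). From then on it wins for good: it beeps
surely, its neighbors climb, and whenever it climbs itself its slack grows too, so its level stays
negative until all neighbors reach the cap and fall silent (`Dominates.update`). Within `L` further
rounds it belongs to the computed set. Hence it suffices that every vertex soon has a winner in its
closed neighborhood.

After `L + 1` rounds all non-winners have level at least 1 (`Settled`). Fix a vertex `v` that is
still uncovered and let `d` be its load, the expected number of beeping neighbors. If the neighbors
likely to hear nothing carry a non-negligible part of `d`, one of them beeps alone with constant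
probability; likewise `v` itself if its level is 1 and `d ≤ 1/10`. Otherwise most of the load sits
on neighbors that probably hear a beep and halve their rates, so `d` contracts in expectation up to
a tiny error; and when `d` is small, `v` tends to move down. Both effects are measured by `(10 d +
1) (11/10) ^ ℓ(v)`, whose expectation, restricted to `v` staying uncovered, shrinks by the factor
49/50.

A small power of this potential, set to 0 once `v` is covered, contracts in both situations
(`sum_coverPotential_update_le`): in the first it grows little even if the potential triples, which
the chance of being covered outweighs. So the probability of remaining uncovered decays
exponentially. The initial potential is at most `11 n 2 ^ L`, polynomial in `n` because `L` is
logarithmic, and a union bound over the vertices concludes. -/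

theorem one_sub_sum_le_prod_one_sub {ι : Type*} (S : Finset ι) {f : ι → ℝ}
    (h0 : ∀ i, 0 ≤ f i) (h1 : ∀ i, f i ≤ 1) : 1 - ∑ i ∈ S, f i ≤ ∏ i ∈ S, (1 - f i) := by
  induction S using Finset.induction_on with
  | empty => simp
  | insert a S ha ih =>
    rw [prod_insert ha, sum_insert ha]
    have h2 := mul_le_mul_of_nonneg_left ih (sub_nonneg.2 (h1 a))
    have h3 := mul_nonneg (h0 a) (sum_nonneg fun i (_ : i ∈ S) => h0 i)
    linarith

/-! ### Independent coins as finite weighted sums. -/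

section ProductWeights

variable {V : Type*} [Fintype V]

/-- The probability that independent coins with biases `p` show the pattern `b`. -/
def coinWeight (p : V → ℝ) (b : V → Bool) : ℝ :=
  ∏ v, if b v = true then p v else 1 - p v

theorem coinWeight_nonneg {p : V → ℝ} (h0 : ∀ v, 0 ≤ p v) (h1 : ∀ v, p v ≤ 1) (b : V → Bool) :
    0 ≤ coinWeight p b := by
  refine prod_nonneg fun v _ => ?_
  split_ifs
  · exact h0 v
  · linarith [h1 v]

theorem eq_true_of_coinWeight_ne_zero {p : V → ℝ} {b : V → Bool} (hb : coinWeight p b ≠ 0)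
    {v : V} (hv : p v = 1) : b v = true := by
  by_contra h
  exact hb (prod_eq_zero (mem_univ v) (by simp [h, hv]))

theorem eq_false_of_coinWeight_ne_zero {p : V → ℝ} {b : V → Bool} (hb : coinWeight p b ≠ 0)
    {v : V} (hv : p v = 0) : b v = false := by
  by_contra h
  exact hb (prod_eq_zero (mem_univ v) (by simp [h, hv]))

theorem sum_coinWeight_mul_prod (p : V → ℝ) (g : V → Bool → ℝ) :
    ∑ b, coinWeight p b * ∏ v, g v (b v) =
      ∏ v, (p v * g v true + (1 - p v) * g v false) := by
  have h := Finset.prod_univ_sum (fun _ : V => (Finset.univ : Finset Bool))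
    (fun v c => (if c = true then p v else 1 - p v) * g v c)
  rw [Fintype.piFinset_univ] at h
  simp only [Fintype.sum_bool, if_true, Bool.false_eq_true, if_false] at h
  rw [h]
  exact sum_congr rfl fun b _ => by rw [coinWeight, prod_mul_distrib]

theorem sum_coinWeight (p : V → ℝ) : ∑ b, coinWeight p b = 1 := by
  simpa using sum_coinWeight_mul_prod p fun _ _ => 1

theorem sum_coinWeight_pattern (p : V → ℝ) {A S : Finset V} (hd : Disjoint A S) :
    ∑ b, coinWeight p b * (if (∀ u ∈ A, b u = true) ∧ ∀ u ∈ S, b u = false then 1 else 0) =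
      (∏ u ∈ A, p u) * ∏ u ∈ S, (1 - p u) := by
  have h := sum_coinWeight_mul_prod p fun v c =>
    (if v ∈ A then if c = true then 1 else 0 else 1) *
      (if v ∈ S then if c = false then 1 else 0 else 1)
  have e1 : ∀ b : V → Bool,
      (∏ v, ((if v ∈ A then if b v = true then (1 : ℝ) else 0 else 1) *
        (if v ∈ S then if b v = false then 1 else 0 else 1))) =
      if (∀ u ∈ A, b u = true) ∧ ∀ u ∈ S, b u = false then 1 else 0 := by
    intro b
    rw [prod_mul_distrib]
    simp only [prod_ite_mem, univ_inter, prod_ite_zero, prod_const_one]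
    split_ifs <;> simp_all
  simp only [e1] at h
  rw [h, ← univ_inter A, ← univ_inter S, ← prod_ite_mem, ← prod_ite_mem, ← prod_mul_distrib]
  refine prod_congr rfl fun v _ => ?_
  by_cases hA : v ∈ A
  · have : v ∉ S := Finset.disjoint_left.1 hd hA
    simp [hA, this]
  · by_cases hS : v ∈ S <;> simp [hA, hS]

theorem sum_coinWeight_silent (p : V → ℝ) (S : Finset V) :
    ∑ b, coinWeight p b * (if ∀ u ∈ S, b u = false then 1 else 0) = ∏ u ∈ S, (1 - p u) := by
  simpa using sum_coinWeight_pattern p (disjoint_empty_left S)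

theorem sum_coinWeight_alone (p : V → ℝ) {v : V} {S : Finset V} (hv : v ∉ S) :
    ∑ b, coinWeight p b * (if b v = true ∧ ∀ u ∈ S, b u = false then 1 else 0) =
      p v * ∏ u ∈ S, (1 - p u) := by
  simpa using sum_coinWeight_pattern p (disjoint_singleton_left.2 hv)

/-- If each vertex of `A` is silent-surrounded with probability at least `η`, then some vertex of
`A` beeps alone with probability at least `η` times the probability that some vertex of `A`
beeps. -/
theorem le_sum_coinWeight_exists_alone {p : V → ℝ} (h0 : ∀ v, 0 ≤ p v) (h1 : ∀ v, p v ≤ 1)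
    {N : V → Finset V} (hN : ∀ u, u ∉ N u) {η : ℝ} (A : Finset V)
    (hA : ∀ u ∈ A, η ≤ ∏ w ∈ N u, (1 - p w)) :
    η * (1 - ∏ u ∈ A, (1 - p u)) ≤
      ∑ b, coinWeight p b *
        (if ∃ u ∈ A, b u = true ∧ ∀ w ∈ N u, b w = false then 1 else 0) := by
  induction A using Finset.induction_on with
  | empty => simp
  | insert a A ha ih =>
    have ih' := ih fun u hu => hA u (mem_insert_of_mem hu)
    have hq0 : ∀ S : Finset V, 0 ≤ ∏ u ∈ S, (1 - p u) := fun S =>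
      prod_nonneg fun u _ => by linarith [h1 u]
    have hq1 : ∀ S : Finset V, ∏ u ∈ S, (1 - p u) ≤ 1 := fun S =>
      prod_le_one (fun u _ => by linarith [h1 u]) fun u _ => by linarith [h0 u]
    -- Merging the two products removes the factors of the overlap; these are at most 1, so the
    -- product over the union can only be larger.
    have hun : η * ∏ u ∈ A, (1 - p u) ≤ ∏ u ∈ N a ∪ A, (1 - p u) := by
      have h := prod_union_inter (s₁ := N a) (s₂ := A) (f := fun u => 1 - p u)
      calc η * ∏ u ∈ A, (1 - p u) ≤ (∏ u ∈ N a, (1 - p u)) * ∏ u ∈ A, (1 - p u) :=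
            mul_le_mul_of_nonneg_right (hA a (mem_insert_self a A)) (hq0 A)
        _ = (∏ u ∈ N a ∪ A, (1 - p u)) * ∏ u ∈ N a ∩ A, (1 - p u) := h.symm
        _ ≤ _ := mul_le_of_le_one_right (hq0 _) (hq1 _)
    have hal := sum_coinWeight_alone p (v := a) (S := N a ∪ A) (by simp [hN a, ha])
    -- The two events on the left are disjoint, since the first silences all of `A`; no correlation
    -- inequality is needed.
    have hsum : ∑ b, coinWeight p b *
          (if b a = true ∧ ∀ u ∈ N a ∪ A, b u = false then 1 else 0) +
        ∑ b, coinWeight p b *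
          (if ∃ u ∈ A, b u = true ∧ ∀ w ∈ N u, b w = false then 1 else 0) ≤
        ∑ b, coinWeight p b *
          (if ∃ u ∈ insert a A, b u = true ∧ ∀ w ∈ N u, b w = false then 1 else 0) := by
      rw [← sum_add_distrib]
      refine sum_le_sum fun b _ => ?_
      rw [← mul_add]
      refine mul_le_mul_of_nonneg_left ?_ (coinWeight_nonneg h0 h1 b)
      by_cases hE : ∃ u ∈ A, b u = true ∧ ∀ w ∈ N u, b w = false
      · obtain ⟨u, hu, hbu, hw⟩ := hE
        have e1 : ¬(b a = true ∧ ∀ u ∈ N a ∪ A, b u = false) := fun h => by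
          have := h.2 u (mem_union_right _ hu)
          simp [hbu] at this
        have e2 : ∃ u ∈ insert a A, b u = true ∧ ∀ w ∈ N u, b w = false :=
          ⟨u, mem_insert_of_mem hu, hbu, hw⟩
        rw [if_neg e1, if_pos e2]
        split_ifs <;> norm_num
      · rw [if_neg hE, add_zero]
        by_cases e1 : b a = true ∧ ∀ u ∈ N a ∪ A, b u = false
        · have e2 : ∃ u ∈ insert a A, b u = true ∧ ∀ w ∈ N u, b w = false :=
            ⟨a, mem_insert_self _ _, e1.1, fun w hw => e1.2 w (mem_union_left _ hw)⟩
          rw [if_pos e1, if_pos e2]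
        · rw [if_neg e1]
          split_ifs <;> norm_num
    rw [hal] at hsum
    rw [prod_insert ha]
    have := mul_le_mul_of_nonneg_left hun (h0 a)
    linarith

end ProductWeights

/-! ### Deterministic dynamics of the levels. -/

section Levels

variable {V : Type*} {G : SimpleGraph V} {L : ℕ} {l : V → ℤ} {b : V → Bool}

/-- The beeping probability as a real number. -/
def rate (L : ℕ) (x : ℤ) : ℝ := (beepProb L x : ℝ)

theorem rate_nonneg (L : ℕ) (x : ℤ) : 0 ≤ rate L x := (beepProb L x).2

theorem rate_le_one (L : ℕ) (x : ℤ) : rate L x ≤ 1 := by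
  exact_mod_cast beepProb_le_one L x

theorem rate_cap (L : ℕ) : rate L L = 0 := by simp [rate, beepProb]

theorem rate_of_nonpos {x : ℤ} (hx : x ≤ 0) (hL : 0 < L) : rate L x = 1 := by
  have h1 : x < (L : ℤ) := by omega
  have h2 : (1 : ℝ≥0) ≤ 2 ^ (-x) := one_le_zpow₀ (by norm_num) (by omega)
  rw [rate, beepProb, if_pos h1, min_eq_right h2, NNReal.coe_one]

theorem rate_of_nonneg {x : ℤ} (hx : 0 ≤ x) (h : x < L) : rate L x = (2 : ℝ) ^ (-x) := by
  have h2 : (2 : ℝ≥0) ^ (-x) ≤ 1 := zpow_le_one_of_nonpos₀ (by norm_num) (by omega)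
  simp only [rate, beepProb, if_pos h, min_eq_left h2]
  push_cast
  rfl

/-- The vertex `w` dominates with slack `k`: its level is within `k` of the bottom level and all
its neighbors have level above `k`. -/
def Dominates (G : SimpleGraph V) (L : ℕ) (k : ℕ) (w : V) (l : V → ℤ) : Prop :=
  k + 1 ≤ L ∧ l w ≤ -(L : ℤ) + k ∧ ∀ u, G.Adj w u → (k : ℤ) + 1 ≤ l u

/-- The beeps `b` are possible at levels `l`, as far as certain beeps and silences go. -/
def Admissible (L : ℕ) (l : V → ℤ) (b : V → Bool) : Prop :=
  (∀ v, l v ≤ 0 → b v = true) ∧ ∀ v, l v = L → b v = false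

theorem admissible_of_coinWeight_ne_zero [Fintype V] (hL : 0 < L)
    (hb : coinWeight (fun v => rate L (l v)) b ≠ 0) : Admissible L l b :=
  ⟨fun _ hv => eq_true_of_coinWeight_ne_zero hb (rate_of_nonpos hv hL),
    fun v hv => eq_false_of_coinWeight_ne_zero hb (by rw [hv]; exact rate_cap L)⟩

theorem IsConfiguration.update (hl : IsConfiguration (fun _ => L) l) (hL : 0 < L) :
    IsConfiguration (fun _ => L) (update G (fun _ => L) l b) := by
  intro v
  have := hl v
  simp only [BeepingMIS.update] at this ⊢
  split_ifs <;> omega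

theorem update_of_hears {v : V} (h : Hears G b v) :
    update G (fun _ => L) l b v = min (l v + 1) L := by simp [update, h]

theorem update_of_alone {v : V} (h : ¬Hears G b v) (hv : b v = true) :
    update G (fun _ => L) l b v = -(L : ℤ) := by simp [update, h, hv]

theorem update_of_silent {v : V} (h : ¬Hears G b v) (hv : b v = false) :
    update G (fun _ => L) l b v = max (l v - 1) 1 := by simp [update, h, hv]

theorem update_le_add_one {v : V} (h1 : 1 ≤ l v) : update G (fun _ => L) l b v ≤ l v + 1 := by
  simp only [update]
  split_ifs <;> omega

theorem dominates_update_of_alone (hL : 0 < L) (hb : Admissible L l b) {w : V}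
    (hw : b w = true) (h : ¬Hears G b w) :
    Dominates G L 0 w (update G (fun _ => L) l b) := by
  refine ⟨hL, by simp [update_of_alone h hw], fun u hu => ?_⟩
  have hbu : b u = false := by
    by_contra hc
    exact h ⟨u, hu, by simpa using hc⟩
  have hlu : 0 < l u := by
    by_contra hc
    simp [hb.1 u (not_lt.1 hc)] at hbu
  rw [update_of_hears ⟨w, hu.symm, hw⟩]
  push_cast
  omega

theorem Dominates.beeps (hb : Admissible L l b) {k : ℕ} {w : V} (h : Dominates G L k w l) :
    b w = true :=
  hb.1 w (by have := h.1; have := h.2.1; omega)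

/-- The winner beeps surely, so every neighbor gains a level. If the winner also hears a beep, it
comes from a neighbor below the cap, which forces `k + 1 < L`, so the slack has room for the level
gained. -/
theorem Dominates.update (hl : IsConfiguration (fun _ => L) l) (hb : Admissible L l b)
    {k : ℕ} {w : V} (h : Dominates G L k w l) :
    Dominates G L (min (k + 1) (L - 1)) w (update G (fun _ => L) l b) := by
  obtain ⟨hk, hw, hn⟩ := id h
  have hbw := h.beeps hb
  have hlw := (hl w).1
  refine ⟨by omega, ?_, fun u hu => ?_⟩
  · by_cases hh : Hears G b w
    · obtain ⟨u, hu, hbu⟩ := id hh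
      have hkL : k + 1 < L := by
        by_contra hc
        have h1 := hn u hu
        have h2 := (hl u).2
        have := hb.2 u (by simp only at h2; omega)
        simp [this] at hbu
      rw [update_of_hears hh]
      omega
    · rw [update_of_alone hh hbw]
      omega
  · have := hn u hu
    rw [update_of_hears ⟨w, hu.symm, hbw⟩]
    omega

theorem mem_misSet_of_dominates_update (hl : IsConfiguration (fun _ => L) l)
    (hb : Admissible L l b) {w : V} (h : Dominates G L (L - 1) w l) :
    w ∈ misSet G (fun _ => L) (update G (fun _ => L) l b) := by
  obtain ⟨hk, hw, hn⟩ := id h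
  have hbw := h.beeps hb
  have hnb : ∀ u, G.Adj w u → l u = L := fun u hu => by
    have h1 := hn u hu
    have h2 := (hl u).2
    simp only at h2
    omega
  have hh : ¬Hears G b w := fun ⟨u, hu, hbu⟩ => by simp [hb.2 u (hnb u hu)] at hbu
  refine ⟨update_of_alone hh hbw, fun u hu => ?_⟩
  rw [update_of_hears ⟨w, hu.symm, hbw⟩, hnb u hu]
  exact min_eq_right (by omega)

theorem dominates_of_mem_misSet (hL : 0 < L) {w : V} (h : w ∈ misSet G (fun _ => L) l) :
    Dominates G L (L - 1) w l := by
  refine ⟨by omega, ?_, fun u hu => ?_⟩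
  · have := h.1
    simp only at this
    omega
  · have := h.2 u hu
    simp only at this
    omega

/-- The vertex `w` dominates with some slack. -/
def Wins (G : SimpleGraph V) (L : ℕ) (w : V) (l : V → ℤ) : Prop := ∃ k, Dominates G L k w l

/-- Neither `v` nor one of its neighbors dominates. -/
def Uncovered (G : SimpleGraph V) (L : ℕ) (v : V) (l : V → ℤ) : Prop :=
  ∀ w, w = v ∨ G.Adj v w → ¬Wins G L w l

theorem Wins.update (hl : IsConfiguration (fun _ => L) l) (hb : Admissible L l b) {w : V}
    (h : Wins G L w l) : Wins G L w (update G (fun _ => L) l b) :=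
  h.elim fun _ hk => ⟨_, hk.update hl hb⟩

theorem Uncovered.of_update (hl : IsConfiguration (fun _ => L) l) (hb : Admissible L l b) {v : V}
    (h : Uncovered G L v (BeepingMIS.update G (fun _ => L) l b)) : Uncovered G L v l :=
  fun w hw hc => h w hw (hc.update hl hb)

/-- A beep without an answering beep would create a winner. So while `v` stays uncovered, no vertex
of its closed neighborhood resets to the bottom level, and levels move by at most one step up or
down. -/
theorem Uncovered.hears (hL : 0 < L) (hb : Admissible L l b) {v w : V}
    (h : Uncovered G L v (BeepingMIS.update G (fun _ => L) l b)) (hw : w = v ∨ G.Adj v w)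
    (hbw : b w = true) : Hears G b w := by
  by_contra hc
  exact h w hw ⟨0, dominates_update_of_alone hL hb hbw hc⟩

/-- Every vertex that does not dominate has level at least `min (k - L) 1`. -/
def Settled (G : SimpleGraph V) (L : ℕ) (k : ℕ) (l : V → ℤ) : Prop :=
  ∀ w, Wins G L w l ∨ min (-(L : ℤ) + k) 1 ≤ l w

theorem settled_zero (hl : IsConfiguration (fun _ => L) l) : Settled G L 0 l := fun w =>
  Or.inr (by have := (hl w).1; simp only at this; push_cast; omega)

/-- Hearing raises the level by one, beeping unheard by others' beeps creates a winner, and silence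
leads to level at least 1. -/
theorem Settled.update (hL : 0 < L) (hl : IsConfiguration (fun _ => L) l)
    (hb : Admissible L l b) {k : ℕ} (h : Settled G L k l) :
    Settled G L (k + 1) (update G (fun _ => L) l b) := by
  intro w
  rcases h w with hw | hw
  · exact Or.inl (hw.update hl hb)
  by_cases hh : Hears G b w
  · right
    rw [update_of_hears hh]
    push_cast
    omega
  · by_cases hbw : b w = true
    · exact Or.inl ⟨0, dominates_update_of_alone hL hb hbw hh⟩
    · right
      rw [update_of_silent hh (by simpa using hbw)]
      omega

theorem Settled.one_le {k : ℕ} (h : Settled G L k l) (hk : L + 1 ≤ k) {v w : V}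
    (hv : Uncovered G L v l) (hw : w = v ∨ G.Adj v w) : 1 ≤ l w := by
  have := (h w).resolve_left (hv w hw)
  omega

theorem rate_le_of_hears {x : ℤ} (hx : 0 ≤ x) : rate L (min (x + 1) L) ≤ rate L x / 2 := by
  rcases lt_or_ge (x + 1) (L : ℤ) with h | h
  · rw [min_eq_left h.le, rate_of_nonneg (by omega) h, rate_of_nonneg hx (by omega), neg_add,
      zpow_add₀ two_ne_zero]
    norm_num
    linarith
  · rw [min_eq_right h, rate_cap]
    exact div_nonneg (rate_nonneg _ _) zero_le_two

/-- The additive term pays for leaving the cap, where the rate jumps from 0 to `2 ^ (1 - L)`. -/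
theorem rate_le_of_silent (hL : 2 ≤ L) {x : ℤ} (hx : 1 ≤ x) (hxL : x ≤ L) :
    rate L (max (x - 1) 1) ≤ 2 * rate L x + (2 : ℝ) ^ (1 - (L : ℤ)) := by
  have h2 : (0 : ℝ) < 2 ^ (1 - (L : ℤ)) := by positivity
  rcases hxL.eq_or_lt with h | h
  · have e : max (x - 1) 1 = (L : ℤ) - 1 := by omega
    rw [e, h, rate_cap, rate_of_nonneg (by omega) (by omega)]
    simp
  · have := rate_nonneg L x
    rcases hx.eq_or_lt with h1 | h1
    · rw [← h1] at this ⊢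
      norm_num
      linarith
    · rw [max_eq_left (by omega), rate_of_nonneg (by omega) (by omega),
        rate_of_nonneg (by omega) h, neg_sub, sub_eq_add_neg, zpow_add₀ two_ne_zero, zpow_one]
      linarith

end Levels

/-! ### Probabilities of runs. -/

section Run

variable {V : Type*} [Fintype V] {G : SimpleGraph V} {L : ℕ}

/-- The probability that the levels are in `S` after `T` rounds from `l`. -/
def runProb (G : SimpleGraph V) (L : ℕ) (T : ℕ) (l : V → ℤ) (S : Set (V → ℤ)) : ℝ :=
  ((run G (fun _ => L) T l).toOuterMeasure S).toReal

theorem run_succ' (T : ℕ) (l : V → ℤ) :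
    run G (fun _ => L) (T + 1) l = (step G (fun _ => L) l).bind (run G (fun _ => L) T) := by
  induction T with
  | zero =>
    rw [run, run, PMF.pure_bind]
    exact (PMF.bind_pure _).symm
  | succ T ih => rw [run, ih, PMF.bind_bind]; rfl

theorem toReal_beeps (l : V → ℤ) (b : V → Bool) :
    (beeps (fun _ => L) l b).toReal = coinWeight (fun v => rate L (l v)) b := by
  rw [beeps, PMF.ofFintype_apply, ENNReal.coe_toReal, coinWeight, NNReal.coe_prod]
  refine prod_congr rfl fun v _ => ?_
  split_ifs
  · rfl
  · rw [NNReal.coe_sub (beepProb_le_one _ _)]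
    rfl

theorem toOuterMeasure_ne_top {α : Type*} (p : PMF α) (S : Set α) :
    p.toOuterMeasure S ≠ ⊤ := by
  refine ne_top_of_le_ne_top ENNReal.one_ne_top ?_
  rw [PMF.toOuterMeasure_apply, ← p.tsum_coe]
  exact ENNReal.tsum_le_tsum fun a => Set.indicator_le_self _ _ _

theorem runProb_zero (l : V → ℤ) (S : Set (V → ℤ)) :
    runProb G L 0 l S = if l ∈ S then 1 else 0 := by
  rw [runProb, run, PMF.toOuterMeasure_pure_apply]
  split_ifs <;> simp

/-- Conditioning on the first round rather than the last lets later bounds be proved by induction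
over all starting levels. -/
theorem runProb_succ (T : ℕ) (l : V → ℤ) (S : Set (V → ℤ)) :
    runProb G L (T + 1) l S = ∑ b, coinWeight (fun v => rate L (l v)) b *
      runProb G L T (update G (fun _ => L) l b) S := by
  have h : ((step G (fun _ => L) l).bind (run G (fun _ => L) T)) =
      (beeps (fun _ => L) l).bind
        (fun b => run G (fun _ => L) T (update G (fun _ => L) l b)) := by
    rw [step, PMF.bind_map]
    rfl
  rw [runProb, run_succ', h, PMF.toOuterMeasure_bind_apply, tsum_fintype, ENNReal.toReal_sum]
  · refine sum_congr rfl fun b _ => ?_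
    rw [ENNReal.toReal_mul, toReal_beeps, runProb]
  · exact fun b _ => ENNReal.mul_ne_top (PMF.apply_ne_top _ _) (toOuterMeasure_ne_top _ _)

theorem runProb_nonneg (T : ℕ) (l : V → ℤ) (S : Set (V → ℤ)) : 0 ≤ runProb G L T l S :=
  ENNReal.toReal_nonneg

theorem rate_coinWeight_nonneg (l : V → ℤ) (b : V → Bool) :
    0 ≤ coinWeight (fun v => rate L (l v)) b :=
  coinWeight_nonneg (fun _ => rate_nonneg _ _) (fun _ => rate_le_one _ _) b

theorem runProb_compl (T : ℕ) (l : V → ℤ) (S : Set (V → ℤ)) :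
    runProb G L T l Sᶜ = 1 - runProb G L T l S := by
  induction T generalizing l with
  | zero =>
    simp only [runProb_zero, Set.mem_compl_iff]
    split_ifs <;> norm_num
  | succ T ih =>
    simp only [runProb_succ, ih, mul_sub, mul_one, sum_sub_distrib, sum_coinWeight]

theorem runProb_iUnion_le {ι : Type*} [Fintype ι] (T : ℕ) (l : V → ℤ) (S : ι → Set (V → ℤ)) :
    runProb G L T l (⋃ i, S i) ≤ ∑ i, runProb G L T l (S i) := by
  induction T generalizing l with
  | zero =>
    simp only [runProb_zero]
    have h0 : ∀ i, (0 : ℝ) ≤ if l ∈ S i then 1 else 0 := fun i => by split_ifs <;> norm_num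
    split_ifs with h
    · obtain ⟨i, hi⟩ := Set.mem_iUnion.1 h
      have := single_le_sum (fun i _ => h0 i) (mem_univ i)
      simpa [hi] using this
    · exact sum_nonneg fun i _ => h0 i
  | succ T ih =>
    simp only [runProb_succ]
    rw [sum_comm]
    refine sum_le_sum fun b _ => ?_
    rw [← mul_sum]
    exact mul_le_mul_of_nonneg_left (ih _) (rate_coinWeight_nonneg l b)

/-- A bound that holds after `T` rounds from each level vector satisfying an invariant which is
surely reached in `k` rounds holds after `k + T` rounds. -/
theorem runProb_add_le {P : ℕ → (V → ℤ) → Prop}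
    (hP : ∀ k l b, P k l → coinWeight (fun v => rate L (l v)) b ≠ 0 →
      P (k + 1) (update G (fun _ => L) l b))
    {T m : ℕ} {S : Set (V → ℤ)} {c : ℝ} (k : ℕ)
    (hc : ∀ l, P (m + k) l → runProb G L T l S ≤ c) {l : V → ℤ} (hl : P m l) :
    runProb G L (T + k) l S ≤ c := by
  induction k generalizing l m with
  | zero => exact hc l hl
  | succ k ih =>
    rw [← add_assoc, runProb_succ]
    calc _ ≤ ∑ b, coinWeight (fun v => rate L (l v)) b * c := by
          refine sum_le_sum fun b _ => ?_
          by_cases hb : coinWeight (fun v => rate L (l v)) b = 0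
          · simp [hb]
          · refine mul_le_mul_of_nonneg_left ?_ (rate_coinWeight_nonneg l b)
            refine ih (m := m + 1) (fun l' h' => hc l' ?_) (hP m l b hl hb)
            rwa [← add_assoc, add_right_comm]
      _ = c := by rw [← sum_mul, sum_coinWeight, one_mul]

end Run

/-! ### Drift of small powers, by Bernoulli's inequality. -/

section PowerDrift

theorem rpow_le_one_add_mul {y s : ℝ} (hy : 0 ≤ y) (h0 : 0 ≤ s) (h1 : s ≤ 1) :
    y ^ s ≤ 1 + s * (y - 1) := by
  have := rpow_one_add_le_one_add_mul_self (s := y - 1) (by linarith) h0 h1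
  rwa [add_sub_cancel] at this

variable {ι : Type*} [Fintype ι] {W X : ι → ℝ} {I : ι → Prop} {Y s : ℝ}

theorem sum_rpow_le_of_sum_le (hW : ∀ i, 0 ≤ W i) (hW1 : ∑ i, W i = 1) (hX : ∀ i, 0 ≤ X i)
    (hY : 0 < Y) (h0 : 0 < s) (h1 : s ≤ 1)
    (h : ∑ i, W i * (if I i then X i else 0) ≤ 49 / 50 * Y) :
    ∑ i, W i * (if I i then X i ^ s else 0) ≤ (1 - s / 50) * Y ^ s := by
  have hpt : ∀ i, W i * (if I i then X i ^ s else 0) ≤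
      (W i * (1 - s) + s / Y * (W i * (if I i then X i else 0))) * Y ^ s := fun i => by
    have hYs : 0 < Y ^ s := Real.rpow_pos_of_pos hY s
    have e : (W i * (1 - s) + s / Y * (W i * (if I i then X i else 0))) * Y ^ s =
        W i * ((1 - s + s * ((if I i then X i else 0) / Y)) * Y ^ s) := by ring
    rw [e]
    refine mul_le_mul_of_nonneg_left ?_ (hW i)
    split_ifs
    · have := rpow_le_one_add_mul (div_nonneg (hX i) hY.le) h0.le h1
      rw [Real.div_rpow (hX i) hY.le, div_le_iff₀ hYs] at this
      linarith
    · rw [zero_div, mul_zero, add_zero]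
      exact mul_nonneg (by linarith) hYs.le
  refine (sum_le_sum fun i _ => hpt i).trans ?_
  rw [← sum_mul, sum_add_distrib, ← sum_mul, ← mul_sum, hW1]
  refine mul_le_mul_of_nonneg_right ?_ (Real.rpow_nonneg hY.le s)
  have := mul_le_mul_of_nonneg_left h (div_nonneg h0.le hY.le)
  have e : s / Y * (49 / 50 * Y) = 49 / 50 * s := by field_simp
  linarith

/-- With exponent `γ / 4`, a threefold increase costs only the factor `1 + (γ / 4) (3 - 1) = 1 + γ /
2`, and `(1 - γ) (1 + γ / 2) ≤ 1 - γ / 2`. -/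
theorem sum_rpow_le_of_le (hW : ∀ i, 0 ≤ W i) (hX : ∀ i, 0 ≤ X i)
    (hY : 0 < Y) {γ : ℝ} (h0 : 0 < γ) (h1 : γ ≤ 1)
    (h : ∀ i, W i ≠ 0 → I i → X i ≤ 3 * Y) (hI : ∑ i, W i * (if I i then 1 else 0) ≤ 1 - γ) :
    ∑ i, W i * (if I i then X i ^ (γ / 4) else 0) ≤ (1 - γ / 2) * Y ^ (γ / 4) := by
  have hYs : 0 < Y ^ (γ / 4) := Real.rpow_pos_of_pos hY _
  have hpt : ∀ i, W i * (if I i then X i ^ (γ / 4) else 0) ≤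
      (W i * (if I i then 1 else 0)) * ((1 + γ / 2) * Y ^ (γ / 4)) := fun i => by
    by_cases hWi : W i = 0
    · simp [hWi]
    rw [mul_assoc]
    refine mul_le_mul_of_nonneg_left ?_ (hW i)
    split_ifs with hi
    · have h3 := h i hWi hi
      have := rpow_le_one_add_mul (div_nonneg (hX i) hY.le) (s := γ / 4) (by linarith)
        (by linarith)
      rw [Real.div_rpow (hX i) hY.le, div_le_iff₀ hYs] at this
      rw [one_mul]
      refine this.trans (mul_le_mul_of_nonneg_right ?_ hYs.le)
      have h4 : X i / Y ≤ 3 := (div_le_iff₀ hY).2 h3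
      nlinarith
    · rw [zero_mul]
  refine (sum_le_sum fun i _ => hpt i).trans ?_
  rw [← sum_mul, ← mul_assoc]
  refine mul_le_mul_of_nonneg_right ?_ hYs.le
  nlinarith

end PowerDrift

/-! ### Load, potential and their drift in one round. -/

section Drift

variable {V : Type*} [Fintype V] {G : SimpleGraph V} {L : ℕ} {l : V → ℤ} {b : V → Bool} {v : V}

/-- The neighbors of `v`. -/
def nbrs (G : SimpleGraph V) (v : V) : Finset V := univ.filter fun u => G.Adj v u

theorem mem_nbrs {u : V} : u ∈ nbrs G v ↔ G.Adj v u := by simp [nbrs]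

theorem not_hears_iff : ¬Hears G b v ↔ ∀ u ∈ nbrs G v, b u = false := by
  simp [Hears, mem_nbrs]

/-- The expected number of beeping neighbors of `v`. -/
def load (G : SimpleGraph V) (L : ℕ) (v : V) (l : V → ℤ) : ℝ :=
  ∑ u ∈ nbrs G v, rate L (l u)

/-- The probability that no neighbor of `v` beeps. -/
def quiet (G : SimpleGraph V) (L : ℕ) (v : V) (l : V → ℤ) : ℝ :=
  ∏ u ∈ nbrs G v, (1 - rate L (l u))

/-- The indicator of the event that no neighbor of `v` beeps. -/
def quietInd (G : SimpleGraph V) (v : V) (b : V → Bool) : ℝ :=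
  if ∀ u ∈ nbrs G v, b u = false then 1 else 0

theorem load_nonneg : 0 ≤ load G L v l := sum_nonneg fun _ _ => rate_nonneg _ _

theorem quiet_le_one : quiet G L v l ≤ 1 :=
  prod_le_one (fun _ _ => sub_nonneg.2 (rate_le_one _ _))
    fun _ _ => sub_le_self _ (rate_nonneg _ _)

theorem one_sub_load_le_quiet : 1 - load G L v l ≤ quiet G L v l :=
  one_sub_sum_le_prod_one_sub _ (fun _ => rate_nonneg _ _) fun _ => rate_le_one _ _

theorem quietInd_nonneg : 0 ≤ quietInd G v b := by
  unfold quietInd; split_ifs <;> norm_num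

theorem quietInd_le_one : quietInd G v b ≤ 1 := by
  unfold quietInd; split_ifs <;> norm_num

theorem quietInd_of_hears (h : Hears G b v) : quietInd G v b = 0 :=
  if_neg fun hc => not_hears_iff.2 hc h

theorem quietInd_of_not_hears (h : ¬Hears G b v) : quietInd G v b = 1 :=
  if_pos (not_hears_iff.1 h)

theorem sum_quietInd : ∑ b, coinWeight (fun v => rate L (l v)) b * quietInd G v b =
    quiet G L v l :=
  sum_coinWeight_silent _ _

/-- A bound for the load of `v` after a round with beeps `b`. -/
def loadBound (G : SimpleGraph V) (L : ℕ) (v : V) (l : V → ℤ) (b : V → Bool) : ℝ :=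
  ∑ u ∈ nbrs G v, (rate L (l u) / 2 +
    (3 / 2 * rate L (l u) + (2 : ℝ) ^ (1 - (L : ℤ))) * quietInd G u b)

theorem load_update_le (hL : 2 ≤ L) (hl : IsConfiguration (fun _ => L) l)
    (hb : Admissible L l b) (h1 : ∀ u, G.Adj v u → 1 ≤ l u)
    (hu : Uncovered G L v (update G (fun _ => L) l b)) :
    load G L v (update G (fun _ => L) l b) ≤ loadBound G L v l b := by
  refine sum_le_sum fun u hu' => ?_
  rw [mem_nbrs] at hu'
  by_cases hh : Hears G b u
  · rw [update_of_hears hh, quietInd_of_hears hh, mul_zero, add_zero]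
    exact rate_le_of_hears (zero_le_one.trans (h1 u hu'))
  · have hbu : b u = false := by
      by_contra hc
      exact hh (hu.hears (by omega) hb (Or.inr hu') (by simpa using hc))
    rw [update_of_silent hh hbu, quietInd_of_not_hears hh]
    have := rate_le_of_silent hL (h1 u hu') (hl u).2
    linarith

theorem loadBound_nonneg : 0 ≤ loadBound G L v l b :=
  sum_nonneg fun u _ => by
    have := rate_nonneg L (l u)
    have := quietInd_nonneg (G := G) (v := u) (b := b)
    positivity

theorem loadBound_le (hΔ : (nbrs G v).card * (2 : ℝ) ^ (1 - (L : ℤ)) ≤ 1 / 16384) :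
    loadBound G L v l b ≤ 2 * load G L v l + 1 / 16384 := by
  have : loadBound G L v l b ≤
      ∑ u ∈ nbrs G v, (2 * rate L (l u) + (2 : ℝ) ^ (1 - (L : ℤ))) := by
    refine sum_le_sum fun u _ => ?_
    have h0 := rate_nonneg L (l u)
    have h2 : (0 : ℝ) < 2 ^ (1 - (L : ℤ)) := by positivity
    have := mul_le_mul_of_nonneg_left (quietInd_le_one (G := G) (v := u) (b := b))
      (show 0 ≤ 3 / 2 * rate L (l u) + (2 : ℝ) ^ (1 - (L : ℤ)) by positivity)
    linarith
  rw [sum_add_distrib, ← mul_sum, sum_const, nsmul_eq_mul] at this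
  exact this.trans (add_le_add le_rfl hΔ)

/-- The neighbors of `v` that have a fair chance of hearing nothing. -/
def lightNbrs (G : SimpleGraph V) (L : ℕ) (v : V) (l : V → ℤ) : Finset V :=
  (nbrs G v).filter fun u => 1 / 15 ≤ quiet G L u l

/-- A neighbor that is not light keeps in expectation at most `1/2 + (3/2) (1/15) = 3/5` of its
rate. The light ones add at most `(3/2) / 16384` and departures from the cap at most `1 / 16384`,
together below `1/5000`. -/
theorem sum_loadBound_le (hΔ : (nbrs G v).card * (2 : ℝ) ^ (1 - (L : ℤ)) ≤ 1 / 16384)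
    (hlight : ∑ u ∈ lightNbrs G L v l, rate L (l u) ≤ 1 / 16384) :
    ∑ b, coinWeight (fun v => rate L (l v)) b * loadBound G L v l b ≤
      3 / 5 * load G L v l + 1 / 5000 := by
  have e : ∑ b, coinWeight (fun v => rate L (l v)) b * loadBound G L v l b =
      ∑ u ∈ nbrs G v, (rate L (l u) / 2 +
        (3 / 2 * rate L (l u) + (2 : ℝ) ^ (1 - (L : ℤ))) * quiet G L u l) := by
    simp only [loadBound, mul_sum]
    rw [sum_comm]
    refine sum_congr rfl fun u _ => ?_
    rw [← sum_quietInd, mul_sum]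
    simp only [mul_add, sum_add_distrib]
    rw [← sum_mul, sum_coinWeight, one_mul]
    congr 1
    exact sum_congr rfl fun b _ => by ring
  rw [e]
  have hpt : ∀ u ∈ nbrs G v, rate L (l u) / 2 +
        (3 / 2 * rate L (l u) + (2 : ℝ) ^ (1 - (L : ℤ))) * quiet G L u l ≤
      3 / 5 * rate L (l u) + (2 : ℝ) ^ (1 - (L : ℤ)) +
        3 / 2 * (if 1 / 15 ≤ quiet G L u l then rate L (l u) else 0) := fun u _ => by
    have h0 := rate_nonneg L (l u)
    have h2 : (0 : ℝ) < 2 ^ (1 - (L : ℤ)) := by positivity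
    have hq1 := quiet_le_one (G := G) (L := L) (v := u) (l := l)
    have := mul_le_mul_of_nonneg_left hq1 h2.le
    split_ifs with hq
    · have := mul_le_mul_of_nonneg_left hq1 h0
      linarith
    · have := mul_le_mul_of_nonneg_left (not_le.1 hq).le h0
      linarith
  refine (sum_le_sum hpt).trans ?_
  rw [sum_add_distrib, sum_add_distrib, ← mul_sum, ← mul_sum, sum_const, nsmul_eq_mul,
    ← sum_filter]
  change 3 / 5 * load G L v l + _ + 3 / 2 * ∑ u ∈ lightNbrs G L v l, rate L (l u) ≤ _
  linarith

/-- The lower bound for the probability that a neighbor of `v` beeps alone when the load from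
light neighbors is not negligible. -/
def aloneProb : ℝ := 1 / 15 * (1 - Real.exp (-(1 / 16384)))

theorem aloneProb_pos : 0 < aloneProb := by
  have : Real.exp (-(1 / 16384)) < 1 := Real.exp_lt_one_iff.2 (by norm_num)
  unfold aloneProb
  linarith

theorem aloneProb_le : aloneProb ≤ 1 / 15 := by
  have := Real.exp_pos (-(1 / 16384))
  unfold aloneProb
  linarith

theorem sum_uncovered_le_of_alone (hL : 0 < L) {E : (V → Bool) → Prop} [DecidablePred E]
    {γ : ℝ}
    (hE : ∀ b, E b → ∃ u, (u = v ∨ G.Adj v u) ∧ b u = true ∧ ¬Hears G b u)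
    (hγ : γ ≤ ∑ b, coinWeight (fun v => rate L (l v)) b * (if E b then 1 else 0)) :
    ∑ b, coinWeight (fun v => rate L (l v)) b *
      (if Uncovered G L v (update G (fun _ => L) l b) then 1 else 0) ≤ 1 - γ := by
  suffices h : ∑ b, coinWeight (fun v => rate L (l v)) b *
        (if Uncovered G L v (update G (fun _ => L) l b) then 1 else 0) +
      ∑ b, coinWeight (fun v => rate L (l v)) b * (if E b then 1 else 0) ≤ 1 by linarith
  rw [← sum_add_distrib]
  refine (sum_le_sum fun b _ => ?_).trans (sum_coinWeight fun v => rate L (l v)).le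
  by_cases hb : coinWeight (fun v => rate L (l v)) b = 0
  · simp [hb]
  rw [← mul_add]
  refine mul_le_of_le_one_right (rate_coinWeight_nonneg l b) ?_
  by_cases hEb : E b
  · have : ¬Uncovered G L v (update G (fun _ => L) l b) := fun hc => by
      obtain ⟨u, hu, hbu, hh⟩ := hE b hEb
      exact hh (hc.hears hL (admissible_of_coinWeight_ne_zero hL hb) hu hbu)
    simp [hEb, this]
  · rw [if_neg hEb, add_zero]
    split_ifs <;> norm_num

theorem sum_uncovered_le_of_light (hL : 0 < L)
    (hlight : 1 / 16384 ≤ ∑ u ∈ lightNbrs G L v l, rate L (l u)) :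
    ∑ b, coinWeight (fun v => rate L (l v)) b *
      (if Uncovered G L v (update G (fun _ => L) l b) then 1 else 0) ≤ 1 - aloneProb := by
  refine sum_uncovered_le_of_alone hL
    (E := fun b => ∃ u ∈ lightNbrs G L v l, b u = true ∧ ∀ w ∈ nbrs G u, b w = false)
    (fun b ⟨u, hu, hbu, hw⟩ => ⟨u, Or.inr (mem_nbrs.1 (mem_filter.1 hu).1), hbu,
      not_hears_iff.2 hw⟩) ?_
  refine le_trans ?_ (le_sum_coinWeight_exists_alone (fun _ => rate_nonneg _ _)
    (fun _ => rate_le_one _ _) (N := nbrs G) (fun u => by simp [mem_nbrs]) (η := 1 / 15) _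
    fun u hu => (mem_filter.1 hu).2)
  refine mul_le_mul_of_nonneg_left (sub_le_sub_left ?_ _) (by norm_num)
  calc ∏ u ∈ lightNbrs G L v l, (1 - rate L (l u))
      ≤ ∏ u ∈ lightNbrs G L v l, Real.exp (-rate L (l u)) :=
        prod_le_prod (fun _ _ => sub_nonneg.2 (rate_le_one _ _))
          fun _ _ => Real.one_sub_le_exp_neg _
    _ = Real.exp (-∑ u ∈ lightNbrs G L v l, rate L (l u)) := by
        rw [← Real.exp_sum, sum_neg_distrib]
    _ ≤ _ := Real.exp_le_exp.2 (neg_le_neg hlight)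

theorem sum_uncovered_le_of_low (hL : 2 ≤ L) (hv : l v = 1) (hd : load G L v l ≤ 1 / 10) :
    ∑ b, coinWeight (fun v => rate L (l v)) b *
      (if Uncovered G L v (update G (fun _ => L) l b) then 1 else 0) ≤ 1 - aloneProb := by
  refine sum_uncovered_le_of_alone (by omega)
    (E := fun b => b v = true ∧ ∀ w ∈ nbrs G v, b w = false)
    (fun b ⟨hbv, hw⟩ => ⟨v, Or.inl rfl, hbv, not_hears_iff.2 hw⟩) ?_
  rw [sum_coinWeight_alone _ (by simp [mem_nbrs])]
  have h1 : rate L (l v) = 1 / 2 := by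
    rw [hv, rate_of_nonneg (by norm_num) (by omega)]
    norm_num
  have h2 := one_sub_load_le_quiet (G := G) (L := L) (v := v) (l := l)
  have h3 := aloneProb_le
  change _ ≤ _ * quiet G L v l
  rw [h1]
  linarith

/-- The potential of `v`. -/
def potential (G : SimpleGraph V) (L : ℕ) (v : V) (l : V → ℤ) : ℝ :=
  (10 * load G L v l + 1) * (11 / 10 : ℝ) ^ (l v)

theorem potential_pos : 0 < potential G L v l := by
  have := load_nonneg (G := G) (L := L) (v := v) (l := l)
  unfold potential
  positivity

theorem potential_update_le (hL : 2 ≤ L) (hl : IsConfiguration (fun _ => L) l)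
    (hb : Admissible L l b) (h1 : ∀ u, u = v ∨ G.Adj v u → 1 ≤ l u)
    (hu : Uncovered G L v (update G (fun _ => L) l b)) :
    potential G L v (update G (fun _ => L) l b) ≤
      11 / 10 * (10 * loadBound G L v l b + 1) * (11 / 10 : ℝ) ^ (l v) := by
  have hd := load_update_le hL hl hb (fun u h => h1 u (Or.inr h)) hu
  have h0 := load_nonneg (G := G) (L := L) (v := v) (l := update G (fun _ => L) l b)
  have hz : (11 / 10 : ℝ) ^ (update G (fun _ => L) l b v) ≤ 11 / 10 * (11 / 10 : ℝ) ^ (l v) := by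
    rw [← zpow_one_add₀ (by norm_num), add_comm]
    exact zpow_le_zpow_right₀ (by norm_num) (update_le_add_one (h1 v (Or.inl rfl)))
  calc potential G L v (update G (fun _ => L) l b)
      ≤ (10 * loadBound G L v l b + 1) * (11 / 10 * (11 / 10 : ℝ) ^ (l v)) :=
        mul_le_mul (by linarith) hz (by positivity) (by linarith)
    _ = _ := by ring

/-- If `v` hears nothing, its level falls and the factor is `10/11`; otherwise it is at most
`11/10`. The correction coefficient is `21/110 = 11/10 - 10/11`, multiplied by the worst-case bound
`loadBound_le` so that only the expectations of `loadBound` and `quietInd` enter, not their product.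
-/
theorem potential_update_le_of_two_le (hL : 2 ≤ L) (hl : IsConfiguration (fun _ => L) l)
    (hb : Admissible L l b) (h1 : ∀ u, u = v ∨ G.Adj v u → 1 ≤ l u) (h2 : 2 ≤ l v)
    (hΔ : (nbrs G v).card * (2 : ℝ) ^ (1 - (L : ℤ)) ≤ 1 / 16384)
    (hu : Uncovered G L v (update G (fun _ => L) l b)) :
    potential G L v (update G (fun _ => L) l b) ≤
      (10 / 11 * (10 * loadBound G L v l b + 1) + 21 / 110 *
        (20 * load G L v l + 10 / 16384 + 1) * (1 - quietInd G v b)) * (11 / 10 : ℝ) ^ (l v) := by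
  have h0 := loadBound_nonneg (G := G) (L := L) (v := v) (l := l) (b := b)
  by_cases hh : Hears G b v
  · refine (potential_update_le hL hl hb h1 hu).trans
      (mul_le_mul_of_nonneg_right ?_ (by positivity))
    rw [quietInd_of_hears hh]
    have := loadBound_le (b := b) (l := l) hΔ
    linarith
  · have hd := load_update_le hL hl hb (fun u h => h1 u (Or.inr h)) hu
    have hbv : b v = false := by
      by_contra hc
      exact hh (hu.hears (by omega) hb (Or.inl rfl) (by simpa using hc))
    rw [potential, quietInd_of_not_hears hh, update_of_silent hh hbv, max_eq_left (by omega),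
      zpow_sub_one₀ (by norm_num)]
    have : (0 : ℝ) < (11 / 10 : ℝ) ^ (l v) := by positivity
    calc _ ≤ (10 * loadBound G L v l b + 1) * ((11 / 10 : ℝ) ^ (l v) * (11 / 10 : ℝ)⁻¹) :=
          mul_le_mul_of_nonneg_right (by linarith) (by positivity)
      _ = _ := by ring

theorem sum_le_of_le {F H : (V → Bool) → ℝ} (hL : 0 < L) (hH : ∀ b, 0 ≤ H b)
    (h : ∀ b, Admissible L l b → Uncovered G L v (update G (fun _ => L) l b) → F b ≤ H b) :
    ∑ b, coinWeight (fun v => rate L (l v)) b *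
        (if Uncovered G L v (update G (fun _ => L) l b) then F b else 0) ≤
      ∑ b, coinWeight (fun v => rate L (l v)) b * H b := by
  refine sum_le_sum fun b _ => ?_
  by_cases hb : coinWeight (fun v => rate L (l v)) b = 0
  · simp [hb]
  refine mul_le_mul_of_nonneg_left ?_ (rate_coinWeight_nonneg l b)
  split_ifs with hu
  · exact h b (admissible_of_coinWeight_ne_zero hL hb) hu
  · exact hH b

theorem sum_coinWeight_affine (p : V → ℝ) (x y z c : ℝ) (F H : (V → Bool) → ℝ) :
    ∑ b, coinWeight p b * ((x * F b + y + z * (1 - H b)) * c) =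
      (x * (∑ b, coinWeight p b * F b) + y + z * (1 - ∑ b, coinWeight p b * H b)) * c := by
  have : ∀ b, coinWeight p b * ((x * F b + y + z * (1 - H b)) * c) =
      x * c * (coinWeight p b * F b) + (y + z) * c * coinWeight p b -
        z * c * (coinWeight p b * H b) := fun b => by ring
  simp only [this, sum_sub_distrib, sum_add_distrib, ← mul_sum, sum_coinWeight]
  ring

theorem sum_potential_update_le (hL : 2 ≤ L) (hl : IsConfiguration (fun _ => L) l)
    (h1 : ∀ u, u = v ∨ G.Adj v u → 1 ≤ l u)
    (hΔ : (nbrs G v).card * (2 : ℝ) ^ (1 - (L : ℤ)) ≤ 1 / 16384)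
    (hlight : ∑ u ∈ lightNbrs G L v l, rate L (l u) ≤ 1 / 16384)
    (hgold : ¬(l v = 1 ∧ load G L v l ≤ 1 / 10)) :
    ∑ b, coinWeight (fun v => rate L (l v)) b *
        (if Uncovered G L v (update G (fun _ => L) l b) then
          potential G L v (update G (fun _ => L) l b) else 0) ≤
      49 / 50 * potential G L v l := by
  have hB := sum_loadBound_le hΔ hlight
  have h0 := load_nonneg (G := G) (L := L) (v := v) (l := l)
  have hz : (0 : ℝ) < (11 / 10 : ℝ) ^ (l v) := by positivity
  have hB0 : ∀ b, 0 ≤ loadBound G L v l b := fun b => loadBound_nonneg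
  have hQ : ∀ b, 0 ≤ 1 - quietInd G v b := fun b => sub_nonneg.2 quietInd_le_one
  unfold potential at *
  rw [← mul_assoc]
  by_cases hd : load G L v l ≤ 1 / 10
  · have h2 : 2 ≤ l v := by
      have := h1 v (Or.inl rfl)
      by_contra hc
      exact hgold ⟨by omega, hd⟩
    refine (sum_le_of_le (H := fun b => (100 / 11 * loadBound G L v l b + 10 / 11 + 21 / 110 *
        (20 * load G L v l + 10 / 16384 + 1) * (1 - quietInd G v b)) * (11 / 10 : ℝ) ^ (l v))
      (by omega) (fun b => ?_) fun b hb hu => ?_).trans ?_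
    · have := hB0 b
      have := hQ b
      positivity
    · refine (potential_update_le_of_two_le hL hl hb h1 h2 hΔ hu).trans (le_of_eq ?_)
      ring
    · rw [sum_coinWeight_affine, sum_quietInd]
      refine mul_le_mul_of_nonneg_right ?_ hz.le
      have hq := one_sub_load_le_quiet (G := G) (L := L) (v := v) (l := l)
      -- Here `load ≤ 1/10` bounds the first factor, and the union bound gives `1 - quiet ≤ load`.
      have : (20 * load G L v l + 10 / 16384 + 1) * (1 - quiet G L v l) ≤
          (3 + 1 / 1000) * load G L v l := mul_le_mul (by linarith) (by linarith)
        (sub_nonneg.2 quiet_le_one) (by norm_num)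
      linarith
  · refine (sum_le_of_le (H := fun b => (11 * loadBound G L v l b + 11 / 10 + 0 *
        (1 - quietInd G v b)) * (11 / 10 : ℝ) ^ (l v))
      (by omega) (fun b => ?_) fun b hb hu => ?_).trans ?_
    · have := hB0 b
      have := hQ b
      positivity
    · refine (potential_update_le hL hl hb h1 hu).trans (le_of_eq ?_)
      ring
    · rw [sum_coinWeight_affine]
      refine mul_le_mul_of_nonneg_right ?_ hz.le
      linarith

/-- The supermartingale that witnesses fast covering of `v`. -/
def coverPotential (G : SimpleGraph V) (L : ℕ) (v : V) (l : V → ℤ) : ℝ :=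
  if Uncovered G L v l then potential G L v l ^ (aloneProb / 4) else 0

theorem sum_coverPotential_update_le (hL : 2 ≤ L) (hl : IsConfiguration (fun _ => L) l)
    (hΔ : (nbrs G v).card * (2 : ℝ) ^ (1 - (L : ℤ)) ≤ 1 / 16384)
    {k : ℕ} (hk : L + 1 ≤ k) (hs : Settled G L k l) :
    ∑ b, coinWeight (fun v => rate L (l v)) b *
        coverPotential G L v (update G (fun _ => L) l b) ≤
      (1 - aloneProb / 200) * coverPotential G L v l := by
  have hγ := aloneProb_pos
  have hγ1 := aloneProb_le
  by_cases hu : Uncovered G L v l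
  · have h1 : ∀ u, u = v ∨ G.Adj v u → 1 ≤ l u := fun u h => hs.one_le hk hu h
    have hpos := potential_pos (G := G) (L := L) (v := v) (l := l)
    simp only [coverPotential, if_pos hu]
    have key : (∑ b, coinWeight (fun v => rate L (l v)) b *
          (if Uncovered G L v (update G (fun _ => L) l b) then 1 else 0) ≤ 1 - aloneProb) ∨
        ∑ b, coinWeight (fun v => rate L (l v)) b *
          (if Uncovered G L v (update G (fun _ => L) l b) then
            potential G L v (update G (fun _ => L) l b) else 0) ≤
        49 / 50 * potential G L v l := by
      rcases le_total (1 / 16384) (∑ u ∈ lightNbrs G L v l, rate L (l u)) with h | h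
      · exact Or.inl (sum_uncovered_le_of_light (by omega) h)
      · by_cases hg : l v = 1 ∧ load G L v l ≤ 1 / 10
        · exact Or.inl (sum_uncovered_le_of_low hL hg.1 hg.2)
        · exact Or.inr (sum_potential_update_le hL hl h1 hΔ h hg)
    rcases key with h | h
    · refine (sum_rpow_le_of_le (rate_coinWeight_nonneg l) (fun b => potential_pos.le) hpos
        hγ (by linarith) (fun b hb hub => ?_) h).trans
        (mul_le_mul_of_nonneg_right (by linarith) (Real.rpow_nonneg hpos.le _))
      refine (potential_update_le hL hl (admissible_of_coinWeight_ne_zero (by omega) hb)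
        h1 hub).trans ?_
      rw [potential, ← mul_assoc]
      refine mul_le_mul_of_nonneg_right ?_ (by positivity)
      have := loadBound_le (b := b) (l := l) hΔ
      have := load_nonneg (G := G) (L := L) (v := v) (l := l)
      linarith
    · refine (sum_rpow_le_of_sum_le (rate_coinWeight_nonneg l) (sum_coinWeight _)
        (fun b => potential_pos.le) hpos (s := aloneProb / 4) (by linarith) (by linarith)
        h).trans (mul_le_mul_of_nonneg_right (by linarith) (Real.rpow_nonneg hpos.le _))
  -- Winners stay winners, so a covered vertex keeps potential 0.
  · rw [coverPotential, if_neg hu, mul_zero]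
    refine sum_nonpos fun b _ => ?_
    by_cases hb : coinWeight (fun v => rate L (l v)) b = 0
    · simp [hb]
    · rw [coverPotential, if_neg fun hc =>
        hu (hc.of_update hl (admissible_of_coinWeight_ne_zero (by omega) hb)), mul_zero]

end Drift

/-! ### From covered vertices to a stable MIS, and the failure bound. -/

section Stability

variable {V : Type*} {G : SimpleGraph V} {L : ℕ} {l : V → ℤ} {b : V → Bool}

/-- Each vertex is in the computed set or has a neighbor there. -/
def Covered (G : SimpleGraph V) (L : ℕ) (l : V → ℤ) : Prop :=
  ∀ v, ∃ w, (w = v ∨ G.Adj v w) ∧ w ∈ misSet G (fun _ => L) l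

theorem Covered.update_eq (hL : 0 < L) (h : Covered G L l) (hb : Admissible L l b) :
    update G (fun _ => L) l b = l := by
  funext v
  obtain ⟨w, rfl | hw, hm⟩ := h v
  · have hh : ¬Hears G b w := fun ⟨u, hu, hbu⟩ => by simp [hb.2 u (hm.2 u hu)] at hbu
    rw [update_of_alone hh (hb.1 w (by have := hm.1; simp only at this; omega)), hm.1]
  · have hbw : b w = true := hb.1 w (by have := hm.1; simp only at this; omega)
    rw [update_of_hears ⟨w, hw, hbw⟩, hm.2 v hw.symm]
    exact min_eq_right (by simp only; omega)

/-- Each vertex has in its closed neighborhood a member of the computed set or a vertex that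
dominates with slack at least `k`. -/
def NearlyCovered (G : SimpleGraph V) (L k : ℕ) (l : V → ℤ) : Prop :=
  IsConfiguration (fun _ => L) l ∧ ∀ v, ∃ w, (w = v ∨ G.Adj v w) ∧
    ((∃ j, k ≤ j ∧ Dominates G L j w l) ∨ w ∈ misSet G (fun _ => L) l)

theorem NearlyCovered.update (hL : 0 < L) {k : ℕ} (h : NearlyCovered G L k l)
    (hb : Admissible L l b) : NearlyCovered G L (k + 1) (update G (fun _ => L) l b) := by
  refine ⟨h.1.update hL, fun v => ?_⟩
  obtain ⟨w, hw, ⟨j, hkj, hj⟩ | hm⟩ := h.2 v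
  · refine ⟨w, hw, ?_⟩
    rcases (show j + 1 ≤ L from hj.1).lt_or_eq with h' | h'
    · exact Or.inl ⟨_, by omega, hj.update h.1 hb⟩
    · obtain rfl : j = L - 1 := by omega
      exact Or.inr (mem_misSet_of_dominates_update h.1 hb hj)
  · exact ⟨w, hw,
      Or.inr (mem_misSet_of_dominates_update h.1 hb (dominates_of_mem_misSet hL hm))⟩

theorem NearlyCovered.covered (h : NearlyCovered G L L l) : Covered G L l := fun v => by
  obtain ⟨w, hw, ⟨j, hkj, hj⟩ | hm⟩ := h.2 v
  · have := hj.1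
    omega
  · exact ⟨w, hw, hm⟩

variable [Fintype V]

theorem Covered.step_eq (hL : 0 < L) (h : Covered G L l) :
    step G (fun _ => L) l = PMF.pure l := by
  have : (beeps (fun _ => L) l).bind (fun b => PMF.pure (update G (fun _ => L) l b)) =
      (beeps (fun _ => L) l).bind fun _ => PMF.pure l := by
    ext x
    rw [PMF.bind_apply, PMF.bind_apply]
    refine tsum_congr fun b => ?_
    by_cases hb : coinWeight (fun v => rate L (l v)) b = 0
    · rw [← toReal_beeps, ENNReal.toReal_eq_zero_iff] at hb
      rw [hb.resolve_right (PMF.apply_ne_top _ _), zero_mul, zero_mul]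
    · rw [h.update_eq hL (admissible_of_coinWeight_ne_zero hL hb)]
  rw [PMF.bind_const] at this
  exact this

theorem Covered.isStableMIS (hL : 0 < L) (h : Covered G L l) :
    IsStableMIS G (fun _ => L) l := by
  refine ⟨⟨fun u hu v hv _ huv => ?_, fun J hJ hIJ v hv => ?_⟩, ?_, fun k => ?_⟩
  · have h1 := hu.2 v huv
    have h2 := hv.1
    simp only at h1 h2
    omega
  · obtain ⟨w, rfl | hw, hm⟩ := h v
    · exact hm
    · exact absurd hw (hJ hv (hIJ hm) hw.ne)
  · refine Set.eq_univ_of_forall fun v => ?_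
    obtain ⟨w, rfl | hw, hm⟩ := h v
    · exact Or.inl hm
    · exact Or.inr ⟨w, hm, hw.symm⟩
  · induction k with
    | zero => rfl
    | succ k ih => rw [run, ih, PMF.pure_bind, h.step_eq hL]

/-- If every vertex is covered after `T` rounds, the slack of each winner grows every round, and `L`
more rounds surely put all of them into the computed set. -/
theorem runProb_not_isStableMIS_le (hL : 0 < L) (T : ℕ) (hl : IsConfiguration (fun _ => L) l) :
    runProb G L (T + L) l {l | ¬IsStableMIS G (fun _ => L) l} ≤
      runProb G L T l (⋃ v, {l | Uncovered G L v l}) := by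
  induction T generalizing l with
  | zero =>
    rw [runProb_zero]
    split_ifs with h
    · have := runProb_compl (G := G) (L := L) (0 + L) l {l | ¬IsStableMIS G (fun _ => L) l}
      have h0 := runProb_nonneg (G := G) (L := L) (0 + L) l
        {l | ¬IsStableMIS G (fun _ => L) l}ᶜ
      linarith
    · refine runProb_add_le (P := NearlyCovered G L)
        (fun k l b h hb => h.update hL (admissible_of_coinWeight_ne_zero hL hb)) (m := 0) L
        (fun l' h' => ?_) ⟨hl, fun v => ?_⟩
      · rw [zero_add] at h'
        rw [runProb_zero, if_neg (fun hc => hc (h'.covered.isStableMIS hL))]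
      · have : ¬Uncovered G L v l := fun hc => h (Set.mem_iUnion.2 ⟨v, hc⟩)
        simp only [Uncovered, not_forall, not_not] at this
        obtain ⟨w, hw, j, hj⟩ := this
        exact ⟨w, hw, Or.inl ⟨j, Nat.zero_le j, hj⟩⟩
  | succ T ih =>
    rw [Nat.add_right_comm, runProb_succ, runProb_succ]
    exact sum_le_sum fun b _ =>
      mul_le_mul_of_nonneg_left (ih (hl.update hL)) (rate_coinWeight_nonneg l b)

theorem runProb_uncovered_le_mul_coverPotential (hL : 2 ≤ L) {v : V}
    (hΔ : (nbrs G v).card * (2 : ℝ) ^ (1 - (L : ℤ)) ≤ 1 / 16384) (T : ℕ)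
    (hl : IsConfiguration (fun _ => L) l) {k : ℕ} (hk : L + 1 ≤ k) (hs : Settled G L k l) :
    runProb G L T l {l | Uncovered G L v l} ≤
      (1 - aloneProb / 200) ^ T * coverPotential G L v l := by
  have hγ1 := aloneProb_le
  induction T generalizing l k with
  | zero =>
    rw [runProb_zero, pow_zero, one_mul, coverPotential]
    by_cases hu : Uncovered G L v l
    · have h1 := hs.one_le hk hu (Or.inl rfl)
      have h0 := load_nonneg (G := G) (L := L) (v := v) (l := l)
      rw [if_pos (show l ∈ {l | Uncovered G L v l} from hu), if_pos hu]
      -- The level of an uncovered vertex is at least 1 after settling, so its potential is at least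
      -- 1 and dominates the indicator.
      exact Real.one_le_rpow (one_le_mul_of_one_le_of_one_le (by linarith)
        (one_le_zpow₀ (by norm_num) (by omega))) (by linarith [aloneProb_pos])
    · rw [if_neg (show l ∉ {l | Uncovered G L v l} from hu), if_neg hu]
  | succ T ih =>
    rw [runProb_succ, pow_succ, mul_assoc]
    calc _ ≤ ∑ b, coinWeight (fun v => rate L (l v)) b *
          ((1 - aloneProb / 200) ^ T * coverPotential G L v (update G (fun _ => L) l b)) := by
          refine sum_le_sum fun b _ => ?_
          by_cases hb : coinWeight (fun v => rate L (l v)) b = 0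
          · simp [hb]
          · exact mul_le_mul_of_nonneg_left
              (ih (hl.update (by omega)) (by omega : L + 1 ≤ k + 1)
                (hs.update (by omega) hl (admissible_of_coinWeight_ne_zero (by omega) hb)))
              (rate_coinWeight_nonneg l b)
      _ = (1 - aloneProb / 200) ^ T * ∑ b, coinWeight (fun v => rate L (l v)) b *
          coverPotential G L v (update G (fun _ => L) l b) := by
          rw [mul_sum]
          exact sum_congr rfl fun b _ => mul_left_comm _ _ _
      _ ≤ _ := mul_le_mul_of_nonneg_left
          (sum_coverPotential_update_le hL hl hΔ hk hs) (pow_nonneg (by linarith) T)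

theorem coverPotential_le (hl : IsConfiguration (fun _ => L) l) (v : V) :
    coverPotential G L v l ≤ 11 * Fintype.card V * 2 ^ L := by
  have hγ := aloneProb_pos
  have hγ1 := aloneProb_le
  have hn : (1 : ℝ) ≤ Fintype.card V := by
    exact_mod_cast Fintype.card_pos_iff.2 ⟨v⟩
  have h2L : (1 : ℝ) ≤ 2 ^ L := one_le_pow₀ (by norm_num)
  have hB : (1 : ℝ) ≤ 11 * Fintype.card V * 2 ^ L :=
    one_le_mul_of_one_le_of_one_le (by linarith) h2L
  have hload : load G L v l ≤ Fintype.card V :=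
    calc load G L v l ≤ ∑ u ∈ nbrs G v, 1 := sum_le_sum fun _ _ => rate_le_one _ _
      _ ≤ Fintype.card V := by
        rw [sum_const, nsmul_eq_mul, mul_one]
        exact_mod_cast card_le_univ _
  have hpot : potential G L v l ≤ 11 * Fintype.card V * 2 ^ L := by
    refine mul_le_mul (by linarith) ?_ (by positivity) (by positivity)
    calc (11 / 10 : ℝ) ^ (l v) ≤ (11 / 10 : ℝ) ^ (L : ℤ) :=
          zpow_le_zpow_right₀ (by norm_num) (hl v).2
      _ = (11 / 10 : ℝ) ^ L := zpow_natCast _ _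
      _ ≤ 2 ^ L := pow_le_pow_left₀ (by norm_num) (by norm_num) L
  rw [coverPotential]
  split_ifs
  · calc potential G L v l ^ (aloneProb / 4)
        ≤ (11 * Fintype.card V * 2 ^ L : ℝ) ^ (aloneProb / 4) :=
          Real.rpow_le_rpow potential_pos.le hpot (by linarith)
      _ ≤ (11 * Fintype.card V * 2 ^ L : ℝ) ^ (1 : ℝ) :=
          Real.rpow_le_rpow_of_exponent_le hB (by linarith)
      _ = _ := Real.rpow_one _
  · linarith

/-- From any configuration, `T + 2 L + 1` rounds fail with probability exponentially small
in `T`. -/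
theorem runProb_not_isStableMIS_le_mul_pow (hL : 2 ≤ L)
    (hΔ : ∀ v, (nbrs G v).card * (2 : ℝ) ^ (1 - (L : ℤ)) ≤ 1 / 16384) (T : ℕ)
    (hl : IsConfiguration (fun _ => L) l) :
    runProb G L (T + L + (L + 1)) l {l | ¬IsStableMIS G (fun _ => L) l} ≤
      Fintype.card V * ((1 - aloneProb / 200) ^ T * (11 * Fintype.card V * 2 ^ L)) := by
  have hγ1 := aloneProb_le
  refine runProb_add_le (P := fun k l => IsConfiguration (fun _ => L) l ∧ Settled G L k l)
    (fun k l b h hb => ⟨h.1.update (by omega), h.2.update (by omega) h.1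
      (admissible_of_coinWeight_ne_zero (by omega) hb)⟩) (m := 0) (L + 1)
    (fun l' ⟨hl', hs⟩ => ?_) ⟨hl, settled_zero hl⟩
  refine (runProb_not_isStableMIS_le (by omega) T hl').trans
    ((runProb_iUnion_le T l' _).trans ?_)
  calc ∑ v, runProb G L T l' {l | Uncovered G L v l}
      ≤ ∑ _v : V, (1 - aloneProb / 200) ^ T * (11 * Fintype.card V * 2 ^ L) :=
        sum_le_sum fun v _ => (runProb_uncovered_le_mul_coverPotential hL (hΔ v) T hl'
          (by omega) hs).trans (mul_le_mul_of_nonneg_left (coverPotential_le hl' v)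
            (pow_nonneg (by linarith) T))
    _ = _ := by rw [sum_const, nsmul_eq_mul, card_univ]

end Stability

/-! ### Numerical estimates and conclusion. -/

theorem nbrs_card_mul_le {V : Type*} [Fintype V] (G : SimpleGraph V) [DecidableRel G.Adj]
    {L : ℕ} {c : ℝ} (hc : 15 ≤ c)
    (h : Real.logb 2 (max (G.maxDegree : ℝ) 1) + c ≤ (L : ℝ)) (v : V) :
    (nbrs G v).card * (2 : ℝ) ^ (1 - (L : ℤ)) ≤ 1 / 16384 := by
  have hm : (0 : ℝ) < max (G.maxDegree : ℝ) 1 := lt_max_of_lt_right one_pos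
  -- This is where `c₁ ≥ 15` enters: `2 / 2 ^ 15 = 1 / 16384`.
  have h1 : max (G.maxDegree : ℝ) 1 * 2 ^ 15 ≤ 2 ^ L := by
    have := Real.rpow_le_rpow_of_exponent_le (x := 2) one_le_two
      (show Real.logb 2 (max (G.maxDegree : ℝ) 1) + (15 : ℕ) ≤ (L : ℝ) by
        push_cast; linarith)
    rwa [Real.rpow_add two_pos, Real.rpow_logb two_pos (by norm_num) hm, Real.rpow_natCast,
      Real.rpow_natCast] at this
  have h2 : ((nbrs G v).card : ℝ) ≤ max (G.maxDegree : ℝ) 1 := by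
    refine le_max_of_le_left ?_
    have e : nbrs G v = G.neighborFinset v := by
      ext u
      simp [mem_nbrs]
    rw [e, G.card_neighborFinset_eq_degree]
    exact_mod_cast G.degree_le_maxDegree v
  rw [zpow_sub₀ two_ne_zero, zpow_one, zpow_natCast, ← mul_div_assoc,
    div_le_iff₀ (by positivity)]
  linarith

/-- The power `(1 - x) ^ T` beats a power of `n` once `T` is a large multiple of `log n`. -/
theorem mul_pow_mul_le_rpow {n x a c : ℝ} {T L : ℕ} (hn : 2 ≤ n) (hx1 : x ≤ 1)
    (hL : (L : ℝ) ≤ c * Real.logb 2 n) (hT : (a + 6 + c) * Real.logb 2 n ≤ x * T)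
    (ha : 0 ≤ a + 6 + c) :
    n * ((1 - x) ^ T * (11 * n * 2 ^ L)) ≤ n ^ (-a) := by
  have hn0 : 0 < n := by linarith
  have hlog : Real.log n ≤ Real.logb 2 n := by
    rw [Real.logb, le_div_iff₀ (Real.log_pos one_lt_two)]
    have h1 : 0 ≤ Real.log n := Real.log_nonneg (by linarith)
    have h2 := Real.log_two_lt_d9
    nlinarith
  have h2L : (2 : ℝ) ^ L ≤ n ^ c := by
    have := Real.rpow_le_rpow_of_exponent_le (x := 2) one_le_two hL
    rwa [Real.rpow_natCast, mul_comm, Real.rpow_mul zero_le_two,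
      Real.rpow_logb two_pos (by norm_num) hn0] at this
  have hpow : (1 - x) ^ T ≤ n ^ (-(a + 6 + c)) := by
    calc (1 - x) ^ T ≤ Real.exp (-x) ^ T :=
          pow_le_pow_left₀ (by linarith) (Real.one_sub_le_exp_neg x) T
      _ = Real.exp (T * -x) := (Real.exp_nat_mul _ _).symm
      _ ≤ Real.exp (Real.log n * -(a + 6 + c)) := by
          rw [Real.exp_le_exp]
          have := mul_le_mul_of_nonneg_left hlog ha
          linarith
      _ = _ := (Real.rpow_def_of_pos hn0 _).symm
  -- The constant 11 is absorbed into `n ^ 4`; with the two factors `n` this makes the 6 in the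
  -- exponent `a + 6 + c`.
  have h11 : (11 : ℝ) ≤ n ^ (4 : ℝ) := by
    rw [show (4 : ℝ) = (4 : ℕ) by norm_num, Real.rpow_natCast]
    have := pow_le_pow_left₀ (by norm_num) hn 4
    linarith
  calc n * ((1 - x) ^ T * (11 * n * 2 ^ L))
      ≤ n * (n ^ (-(a + 6 + c)) * (n ^ (4 : ℝ) * n * n ^ c)) := by gcongr
    _ = n ^ ((1 : ℝ) + (-(a + 6 + c) + (4 + 1 + c))) := by
        rw [Real.rpow_add hn0, Real.rpow_add hn0 _ (4 + 1 + c), Real.rpow_add hn0,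
          Real.rpow_add hn0 4 1, Real.rpow_one]
    _ = n ^ (-a) := by ring_nf

end

end BeepingMIS

theorem theorem1 (c₁ c₂ : ℝ) (hc₁ : 15 ≤ c₁) (hc₂ : 0 < c₂) (a : ℝ) (ha : 0 < a) :
    ∃ C : ℝ, 0 < C ∧
      ∀ (V : Type*) [Fintype V] (G : SimpleGraph V) [DecidableRel G.Adj]
        (lmax : V → ℕ) (L : ℕ),
        (∀ v, lmax v = L) →
        Real.logb 2 (max (G.maxDegree : ℝ) 1) + c₁ ≤ (L : ℝ) →
        (L : ℝ) ≤ c₂ * Real.logb 2 (Fintype.card V : ℝ) →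
        ∀ l₀ : V → ℤ, BeepingMIS.IsConfiguration lmax l₀ →
          1 - (Fintype.card V : ℝ) ^ (-a) ≤
            ((BeepingMIS.run G lmax ⌊C * Real.logb 2 (Fintype.card V : ℝ)⌋₊ l₀).toOuterMeasure
              {l | BeepingMIS.IsStableMIS G lmax l}).toReal := by
  have hγ := BeepingMIS.aloneProb_pos
  have hγ1 := BeepingMIS.aloneProb_le
  set x := BeepingMIS.aloneProb / 200 with hx
  have hx0 : 0 < x := by positivity
  -- The term `2 * c₂` pays for the `2 L` rounds of settling and finishing, 2 for the extra settling
  -- round and the floor, and the quotient for the `T` rounds of exponential decay.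
  refine ⟨2 * c₂ + 2 + (a + 6 + c₂) / x, by positivity, ?_⟩
  intro V _ G _ lmax L hlmax hlow hup l₀ hl₀
  obtain rfl : lmax = fun _ => L := funext hlmax
  set n : ℝ := (Fintype.card V : ℝ) with hn
  have hL15 : (15 : ℝ) ≤ L := by
    have : 0 ≤ Real.logb 2 (max (G.maxDegree : ℝ) 1) :=
      Real.logb_nonneg one_lt_two (le_max_right _ _)
    linarith
  have hL : 2 ≤ L := by
    have : 15 ≤ L := by exact_mod_cast hL15
    omega
  -- For `n ≤ 1` the logarithm vanishes and the upper bound on `L` contradicts `L ≥ 15`.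
  have hn2 : 2 ≤ n := by
    by_contra hc
    have h1 : Fintype.card V ≤ 1 := by
      have : Fintype.card V < 2 := by
        rw [hn] at hc
        exact_mod_cast not_le.1 hc
      omega
    have h2 : Real.logb 2 n = 0 := by
      rcases Nat.le_one_iff_eq_zero_or_eq_one.1 h1 with h | h <;> simp [hn, h]
    rw [h2, mul_zero] at hup
    linarith
  have hlog : 1 ≤ Real.logb 2 n := by
    rw [Real.le_logb_iff_rpow_le one_lt_two (by linarith), Real.rpow_one]
    exact hn2
  have hq : 0 < (a + 6 + c₂) / x := by positivity
  set R := ⌊(2 * c₂ + 2 + (a + 6 + c₂) / x) * Real.logb 2 n⌋₊ with hR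
  have hRlt : (2 * c₂ + 2 + (a + 6 + c₂) / x) * Real.logb 2 n < R + 1 := Nat.lt_floor_add_one _
  have hqlog : 0 < (a + 6 + c₂) / x * Real.logb 2 n := by positivity
  have hRL : L + (L + 1) ≤ R := by
    have : ((L + (L + 1) : ℕ) : ℝ) < ((R + 1 : ℕ) : ℝ) := by
      push_cast
      linarith
    have : L + (L + 1) < R + 1 := by exact_mod_cast this
    omega
  obtain ⟨T, hT⟩ : ∃ T, R = T + L + (L + 1) := ⟨R - (L + (L + 1)), by omega⟩
  have hTx : (a + 6 + c₂) * Real.logb 2 n ≤ x * T := by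
    have h1 : (a + 6 + c₂) / x * Real.logb 2 n ≤ T := by
      have : (R : ℝ) = T + L + (L + 1) := by exact_mod_cast hT
      linarith
    rw [div_mul_eq_mul_div, div_le_iff₀ hx0] at h1
    linarith
  have h1 := BeepingMIS.runProb_not_isStableMIS_le_mul_pow hL
    (BeepingMIS.nbrs_card_mul_le G hc₁ hlow) T hl₀
  have h2 := h1.trans (BeepingMIS.mul_pow_mul_le_rpow hn2 (by linarith) hup hTx (by positivity))
  have h3 := BeepingMIS.runProb_compl (G := G) (L := L) (T + L + (L + 1)) l₀
    {l | BeepingMIS.IsStableMIS G (fun _ => L) l}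
  rw [hT]
  change _ ≤ BeepingMIS.runProb G L (T + L + (L + 1)) l₀ _
  rw [Set.compl_ofPred] at h3
  linarith
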